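/- Let $\hat f(\xi)=\int_{\mathbb R}e^{-ix\xi}f(x)\,dx$ denote the Fourier transform on $L^2(\mathbb R)$, let $H^+$ be the Hardy space of all $f\in L^2(\mathbb R)$ whose Fourier transform vanishes almost everywhere on $(-\infty,0)$, and let $C_+:L^2(\mathbb R)\to H^+$ be the Cauchy projection, $\widehat{C_+f}=\chi_{(0,\infty)}\hat f$. Let $u:\mathbb R\to\mathbb R$ be a real-valued function with $u\in L^2(\mathbb R)\cap L^\infty(\mathbb R)$ and $xu(x)\in L^2(\mathbb R)$, and let $L_u$ be the operator on $H^+$ with domain $H^+\cap H^1(\mathbb R)$ given by $$L_u\varphi=\frac1i\,\partial_x\varphi-C_+(u\,C_+\varphi).$$ If $\lambda<0$ is an eigenvalue of $L_u$ and $\varphi$ is an eigenvector for $\lambda$ (that is, $\varphi\ne0$ lies in the domain of $L_u$ and $L_u\varphi=\lambda\varphi$), then $u\varphi$ is integrable and $$\left|\int_{\mathbb R}u\varphi\,dx\right|^2=2\pi|\lambda|\int_{\mathbb R}|\varphi|^2\,dx .$$ In particular $\int_{\mathbb R}u\varphi\,dx\neq0$. -/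

import Mathlib

open MeasureTheory FourierTransform SchwartzMap
open scoped ENNReal LineDeriv

noncomputable section

namespace BenjaminOno

/-- The complex Hilbert space `L²(ℝ)`. -/
abbrev L2 : Type := Lp ℂ 2 (volume : Measure ℝ)

/-- Multiplication by an essentially bounded function, as an operator on `L²(ℝ)`. -/
def mulOp (m : ℝ → ℂ) (hm : MemLp m ∞ volume) : L2 →L[ℂ] L2 :=
  (ContinuousLinearMap.mul ℂ ℂ).holderL volume ∞ 2 2 (hm.toLp m)

theorem mulOp_ae (m : ℝ → ℂ) (hm : MemLp m ∞ volume) (φ : L2) :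
    mulOp m hm φ =ᵐ[volume] fun x => m x * φ x := by
  have h := (ContinuousLinearMap.mul ℂ ℂ).coeFn_holder (r := 2) (hm.toLp m) φ
  filter_upwards [h, hm.coeFn_toLp] with x hx hx'
  rw [← hx']
  exact hx

/-- The Hardy space `H⁺`: the `L²` functions whose Fourier transform is supported on the positive
half line. Here and below `𝓕 f (ξ) = ∫ exp (-2πixξ) f(x) dx`; this is the transform
`∫ exp (-ixξ) f(x) dx` up to a dilation by the positive factor `2π`, which preserves half lines. -/
def hardyPlus : Submodule ℂ L2 where
  carrier := {f | ∀ᵐ ξ : ℝ, ξ < 0 → (𝓕 f : L2) ξ = 0}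
  zero_mem' := by
    change ∀ᵐ ξ : ℝ, ξ < 0 → (𝓕 (0 : L2) : L2) ξ = 0
    have h0 : (𝓕 (0 : L2) : L2) = 0 := (Lp.fourierTransformₗᵢ ℝ ℂ).map_zero
    rw [h0]
    filter_upwards [Lp.coeFn_zero ℂ 2 (volume : Measure ℝ)] with ξ hξ _
    exact hξ
  add_mem' := by
    intro f g hf hg
    change ∀ᵐ ξ : ℝ, ξ < 0 → (𝓕 (f + g) : L2) ξ = 0
    rw [FourierTransform.fourier_add]
    filter_upwards [Lp.coeFn_add (𝓕 f : L2) (𝓕 g : L2), hf, hg] with ξ h h1 h2 hξ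
    rw [h, Pi.add_apply, h1 hξ, h2 hξ, add_zero]
  smul_mem' := by
    intro c f hf
    change ∀ᵐ ξ : ℝ, ξ < 0 → (𝓕 (c • f) : L2) ξ = 0
    rw [FourierTransform.fourier_smul]
    filter_upwards [Lp.coeFn_smul c (𝓕 f : L2), hf] with ξ h h1 hξ
    rw [h, Pi.smul_apply, h1 hξ, smul_zero]

/-- The indicator function of the positive half line. -/
def posIndicator : ℝ → ℂ := Set.indicator (Set.Ioi 0) 1

theorem memLp_posIndicator : MemLp posIndicator ∞ volume :=
  (memLp_top_const (1 : ℂ)).indicator measurableSet_Ioi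

/-- The Cauchy projection `C₊ : L² → H⁺`, the Fourier multiplier with symbol `χ_{(0,∞)}`. -/
def cauchyPlus : L2 →ₗ[ℂ] hardyPlus where
  toFun φ := ⟨𝓕⁻ (mulOp posIndicator memLp_posIndicator (𝓕 φ)), by
    change ∀ᵐ ξ : ℝ, ξ < 0 → (𝓕 (𝓕⁻ (mulOp posIndicator memLp_posIndicator (𝓕 φ))) : L2) ξ = 0
    rw [FourierTransform.fourier_fourierInv_eq]
    filter_upwards [mulOp_ae posIndicator memLp_posIndicator (𝓕 φ)] with ξ h hξ
    rw [h, posIndicator, Set.indicator_of_notMem (by simpa using hξ.le), zero_mul]⟩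
  map_add' φ ψ := by
    ext1
    simp [FourierTransform.fourier_add, FourierTransform.fourierInv_add]
  map_smul' c φ := by
    ext1
    simp [FourierTransform.fourier_smul, FourierTransform.fourierInv_smul]

/-- The Sobolev space `H¹(ℝ)` as a subspace of `L²(ℝ)`. -/
def sobolevOne : Submodule ℂ L2 where
  carrier := {f | TemperedDistribution.MemSobolev 1 2 (f : 𝓢'(ℝ, ℂ))}
  zero_mem' := by
    change TemperedDistribution.MemSobolev 1 2 (Lp.toTemperedDistributionCLM ℂ volume 2 0)
    rw [map_zero]
    exact TemperedDistribution.memSobolev_fun_zero ℝ ℂ 1 2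
  add_mem' := by
    intro f g hf hg
    change TemperedDistribution.MemSobolev 1 2 (Lp.toTemperedDistributionCLM ℂ volume 2 (f + g))
    rw [map_add]
    exact hf.add hg
  smul_mem' := by
    intro c f hf
    change TemperedDistribution.MemSobolev 1 2 (Lp.toTemperedDistributionCLM ℂ volume 2 (c • f))
    rw [map_smul]
    exact hf.smul c

theorem exists_weakDeriv (f : sobolevOne) :
    ∃ g : L2, ∂_{(1 : ℝ)} ((f : L2) : 𝓢'(ℝ, ℂ)) = (g : 𝓢'(ℝ, ℂ)) := by
  have h := TemperedDistribution.MemSobolev.lineDerivOp (m := (1 : ℝ)) f.2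
  rw [sub_self] at h
  exact TemperedDistribution.memSobolev_zero_iff.1 h

theorem toTemperedDistribution_injective {f g : L2}
    (h : (f : 𝓢'(ℝ, ℂ)) = (g : 𝓢'(ℝ, ℂ))) : f = g :=
  LinearMap.ker_eq_bot.1 Lp.ker_toTemperedDistributionCLM_eq_bot h

/-- The derivative `∂ₓ : H¹(ℝ) → L²(ℝ)`: the `L²` function that represents the distributional
derivative. -/
def weakDeriv : sobolevOne →ₗ[ℂ] L2 where
  toFun f := (exists_weakDeriv f).choose
  map_add' f g := by
    apply toTemperedDistribution_injective
    rw [← (exists_weakDeriv (f + g)).choose_spec]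
    change ∂_{(1 : ℝ)} (Lp.toTemperedDistributionCLM ℂ volume 2 ((f : L2) + (g : L2))) =
      Lp.toTemperedDistributionCLM ℂ volume 2 _
    rw [map_add, map_add, LineDeriv.lineDerivOp_add]
    exact congrArg₂ _ (exists_weakDeriv f).choose_spec (exists_weakDeriv g).choose_spec
  map_smul' c f := by
    apply toTemperedDistribution_injective
    rw [← (exists_weakDeriv (c • f)).choose_spec]
    change ∂_{(1 : ℝ)} (Lp.toTemperedDistributionCLM ℂ volume 2 (c • (f : L2))) =
      Lp.toTemperedDistributionCLM ℂ volume 2 _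
    rw [RingHom.id_apply, map_smul, map_smul, LineDeriv.lineDerivOp_smul]
    exact congrArg _ (exists_weakDeriv f).choose_spec

theorem weakDeriv_spec (f : sobolevOne) :
    ∂_{(1 : ℝ)} ((f : L2) : 𝓢'(ℝ, ℂ)) = (weakDeriv f : 𝓢'(ℝ, ℂ)) :=
  (exists_weakDeriv f).choose_spec

theorem fourier_weakDeriv_ae (f : sobolevOne) :
    (𝓕 (weakDeriv f) : L2) =ᵐ[volume]
      fun ξ : ℝ => (2 * Real.pi * Complex.I * ξ) * (𝓕 (f : L2) : L2) ξ := by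
  have key : ((𝓕 (weakDeriv f) : L2) : 𝓢'(ℝ, ℂ)) =
      (2 * Real.pi * Complex.I) • TemperedDistribution.smulLeftCLM ℂ
        (fun ξ : ℝ => ((inner ℝ ξ (1 : ℝ) : ℝ) : ℂ)) ((𝓕 (f : L2) : L2) : 𝓢'(ℝ, ℂ)) := by
    rw [← Lp.fourier_toTemperedDistribution_eq, ← weakDeriv_spec,
      TemperedDistribution.fourier_lineDerivOp_eq, Lp.fourier_toTemperedDistribution_eq]
  have hloc : ∀ g : L2, LocallyIntegrable g volume := fun g =>
    (Lp.memLp g).locallyIntegrable (by norm_num)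
  have hcont : Continuous fun ξ : ℝ => 2 * (Real.pi : ℂ) * Complex.I * (ξ : ℂ) := by fun_prop
  apply ae_eq_of_integral_contDiff_smul_eq (hloc _)
  · exact LocallyIntegrable.continuous_mul hcont (hloc _)
  · intro g hg hgc
    have hsm : ContDiff ℝ (⊤ : ℕ∞) (fun x : ℝ => (g x : ℂ)) := Complex.ofRealCLM.contDiff.comp hg
    have hsc : HasCompactSupport (fun x : ℝ => (g x : ℂ)) :=
      hgc.comp_left (g := fun y : ℝ => (y : ℂ)) Complex.ofReal_zero
    have h := congrArg (fun T : 𝓢'(ℝ, ℂ) => T (hsc.toSchwartzMap hsm)) key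
    have hin : (fun ξ : ℝ => ((inner ℝ ξ (1 : ℝ) : ℝ) : ℂ)).HasTemperateGrowth := by fun_prop
    calc ∫ x, g x • (𝓕 (weakDeriv f) : L2) x
        = ((𝓕 (weakDeriv f) : L2) : 𝓢'(ℝ, ℂ)) (hsc.toSchwartzMap hsm) := by
          rw [Lp.toTemperedDistribution_apply]
          simp
      _ = (2 * Real.pi * Complex.I) * ∫ x : ℝ, ((x : ℂ) * (g x : ℂ)) * (𝓕 (f : L2) : L2) x := by
          refine h.trans ?_
          change (2 * Real.pi * Complex.I) • (((𝓕 (f : L2) : L2) : 𝓢'(ℝ, ℂ))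
            (SchwartzMap.smulLeftCLM ℂ _ (hsc.toSchwartzMap hsm))) = _
          rw [Lp.toTemperedDistribution_apply, smul_eq_mul]
          simp_rw [SchwartzMap.smulLeftCLM_apply_apply hin]
          simp
      _ = _ := by
          rw [← integral_const_mul]
          congr 1
          ext x
          rw [Complex.real_smul]
          ring

theorem weakDeriv_mem_hardyPlus (f : sobolevOne) (hf : (f : L2) ∈ hardyPlus) :
    weakDeriv f ∈ hardyPlus := by
  change ∀ᵐ ξ : ℝ, ξ < 0 → (𝓕 (weakDeriv f) : L2) ξ = 0
  filter_upwards [fourier_weakDeriv_ae f, hf] with ξ h h0 hξ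
  simp [h, h0 hξ]

/-- The operator `-i ∂ₓ` on `H⁺`, with domain `H⁺ ∩ H¹(ℝ)`. -/
def momentum : hardyPlus →ₗ.[ℂ] hardyPlus where
  domain := sobolevOne.comap hardyPlus.subtype
  toFun := (1 / Complex.I) •
    (weakDeriv ∘ₗ hardyPlus.subtype.restrict fun _ h => h).codRestrict hardyPlus
      fun φ => weakDeriv_mem_hardyPlus _ φ.1.2

/-- The Toeplitz operator `φ ↦ C₊ (u C₊ φ)` on `H⁺`. -/
def toeplitz (u : ℝ → ℝ) (hu : MemLp u ∞ volume) : hardyPlus →ₗ[ℂ] hardyPlus :=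
  cauchyPlus ∘ₗ (mulOp (fun x => (u x : ℂ)) hu.ofReal).toLinearMap ∘ₗ
    hardyPlus.subtype ∘ₗ cauchyPlus ∘ₗ hardyPlus.subtype

/-- The Lax operator `L_u φ = -i ∂ₓ φ - C₊ (u C₊ φ)` of the Benjamin–Ono equation: an unbounded
operator on `H⁺` with domain `H⁺ ∩ H¹(ℝ)`. -/
def laxOp (u : ℝ → ℝ) (hu : MemLp u ∞ volume) : hardyPlus →ₗ.[ℂ] hardyPlus where
  domain := momentum.domain
  toFun := momentum.toFun - toeplitz u hu ∘ₗ momentum.domain.subtype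

/-- `φ` is an eigenvector of the unbounded operator `T` with eigenvalue `z`: it is a nonzero element
of the domain of `T` with `T φ = z φ`. -/
def IsEigenvector {E : Type*} [AddCommGroup E] [Module ℂ E] (T : E →ₗ.[ℂ] E) (z : ℂ) (φ : E) :
    Prop :=
  φ ≠ 0 ∧ ∃ h : φ ∈ T.domain, T ⟨φ, h⟩ = z • φ

end BenjaminOno

end

/-!
Write `f = u φ` and let `𝓕` be the Fourier transform with kernel `exp (-2πixξ)`. For `ξ > 0` the
eigenvalue equation reads `(2πξ - λ) 𝓕 φ = 𝓕 f`, so the derivative of `‖𝓕 f‖² / (2πξ - λ)` is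
`2 Re ⟪d(𝓕 f)/dξ, 𝓕 φ⟫ - 2π ‖𝓕 φ‖²`. Integrate over `(0, ∞)`, which carries all of `𝓕 φ`: the left
side gives `-|∫ f|² / |λ|`, the last term gives `-2π ‖φ‖²` by Plancherel, and the cross term
vanishes, because by Parseval it is twice the real part of `∫ ⟪-2πi x u φ, φ⟫`, which is imaginary
as `u` is real.
-/

namespace BenjaminOno

open Filter Topology Complex

section FourierIntegral

theorem ae_eq_of_integral_schwartz_smul_eq {V E : Type*} [NormedAddCommGroup V]
    [NormedSpace ℝ V] [FiniteDimensional ℝ V] [MeasurableSpace V] [BorelSpace V]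
    [NormedAddCommGroup E] [NormedSpace ℂ E] [CompleteSpace E] {μ : Measure V} {f g : V → E}
    (hf : LocallyIntegrable f μ) (hg : LocallyIntegrable g μ)
    (h : ∀ s : 𝓢(V, ℂ), ∫ x, s x • f x ∂μ = ∫ x, s x • g x ∂μ) : f =ᵐ[μ] g := by
  refine ae_eq_of_integral_contDiff_smul_eq hf hg fun s hs hsc => ?_
  have hs' : ContDiff ℝ (⊤ : ℕ∞) fun x => (s x : ℂ) := ofRealCLM.contDiff.comp hs
  have hsc' : HasCompactSupport fun x => (s x : ℂ) :=
    hsc.comp_left (g := fun y : ℝ => (y : ℂ)) ofReal_zero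
  simpa using h (hsc'.toSchwartzMap hs')

variable {V E : Type*} [NormedAddCommGroup V] [InnerProductSpace ℝ V] [FiniteDimensional ℝ V]
  [MeasurableSpace V] [BorelSpace V]

section NormedSpace

variable [NormedAddCommGroup E] [NormedSpace ℂ E] {f : V → E}

theorem norm_fourier_le_integral_norm (f : V → E) (ξ : V) : ‖𝓕 f ξ‖ ≤ ∫ x, ‖f x‖ :=
  VectorFourier.norm_fourierIntegral_le_integral_norm _ _ _ _ _

theorem continuous_fourier_of_integrable (hf : Integrable f) : Continuous (𝓕 f) :=
  VectorFourier.fourierIntegral_continuous Real.continuous_fourierChar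
    (innerSL ℝ).continuous₂ hf

theorem continuous_fourierInv_of_integrable (hf : Integrable f) : Continuous (𝓕⁻ f) := by
  rw [Real.fourierInv_eq_fourier_comp_neg]
  exact continuous_fourier_of_integrable hf.comp_neg

theorem integral_fourier_smul_eq_of_integrable [CompleteSpace E] {s : V → ℂ} (hs : Integrable s)
    (hf : Integrable f) : ∫ ξ, 𝓕 s ξ • f ξ = ∫ x, s x • 𝓕 f x := by
  simpa using! VectorFourier.integral_fourierIntegral_smul_eq_flip (L := innerₗ V)
    Real.continuous_fourierChar continuous_inner hs hf

theorem integral_fourierInv_smul_eq_of_integrable [CompleteSpace E] {s : V → ℂ}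
    (hs : Integrable s) (hf : Integrable f) : ∫ ξ, 𝓕⁻ s ξ • f ξ = ∫ x, s x • 𝓕⁻ f x := by
  simp_rw [Real.fourierInv_eq_fourier_neg f]
  rw [Real.fourierInv_eq_fourier_comp_neg, integral_fourier_smul_eq_of_integrable hs.comp_neg hf,
    ← integral_neg_eq_self]
  simp only [neg_neg]

end NormedSpace

section L2

variable [NormedAddCommGroup E] [InnerProductSpace ℂ E]

theorem integral_norm_sq_eq_norm_sq {α : Type*} [MeasurableSpace α] {μ : Measure α}
    (f : Lp E 2 μ) : ∫ x, ‖f x‖ ^ 2 ∂μ = ‖f‖ ^ 2 := by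
  have h : inner ℂ f f = ∫ x, inner ℂ (f x) (f x) ∂μ := L2.inner_def f f
  simp only [inner_self_eq_norm_sq_to_K] at h
  exact_mod_cast h.symm

theorem integrable_inner_fourier {f g : V → E} (hf : Integrable f) (hg : Integrable g) :
    Integrable fun ξ => inner ℂ (𝓕 f ξ) (g ξ) := by
  refine (hg.norm.const_mul (∫ x, ‖f x‖)).mono'
    ((continuous_fourier_of_integrable hf).aestronglyMeasurable.inner hg.aestronglyMeasurable)
    (.of_forall fun ξ => (norm_inner_le_norm _ _).trans ?_)
  gcongr
  exact norm_fourier_le_integral_norm f ξ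

variable [CompleteSpace E]

theorem integral_inner_fourier_eq_of_integrable {f g : V → E} (hf : Integrable f)
    (hg : Integrable g) : ∫ ξ, inner ℂ (𝓕 f ξ) (g ξ) = ∫ x, inner ℂ (f x) (𝓕⁻ g x) := by
  simpa using! VectorFourier.integral_sesq_fourierIntegral_eq_neg_flip (innerSL ℂ)
    (L := innerₗ V) Real.continuous_fourierChar continuous_inner hf hg

theorem fourier_ae_eq_of_integrable {f : Lp E 2 (volume : Measure V)} (hf : Integrable f) :
    (𝓕 f : Lp E 2 (volume : Measure V)) =ᵐ[volume] 𝓕 (f : V → E) := by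
  refine ae_eq_of_integral_schwartz_smul_eq ((Lp.memLp _).locallyIntegrable one_le_two)
    (continuous_fourier_of_integrable hf).locallyIntegrable fun s => ?_
  rw [← Lp.toTemperedDistribution_apply (𝓕 f : Lp E 2 (volume : Measure V)),
    ← Lp.fourier_toTemperedDistribution_eq, TemperedDistribution.fourier_apply,
    Lp.toTemperedDistribution_apply, SchwartzMap.fourier_coe,
    integral_fourier_smul_eq_of_integrable s.integrable hf]

theorem fourierInv_ae_eq_of_integrable {f : Lp E 2 (volume : Measure V)} (hf : Integrable f) :
    (𝓕⁻ f : Lp E 2 (volume : Measure V)) =ᵐ[volume] 𝓕⁻ (f : V → E) := by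
  refine ae_eq_of_integral_schwartz_smul_eq ((Lp.memLp _).locallyIntegrable one_le_two)
    (continuous_fourierInv_of_integrable hf).locallyIntegrable fun s => ?_
  rw [← Lp.toTemperedDistribution_apply (𝓕⁻ f : Lp E 2 (volume : Measure V)),
    ← Lp.fourierInv_toTemperedDistribution_eq, TemperedDistribution.fourierInv_apply,
    Lp.toTemperedDistribution_apply, SchwartzMap.fourierInv_coe,
    integral_fourierInv_smul_eq_of_integrable s.integrable hf]

theorem integral_inner_fourier_fourier_of_integrable {f : V → E} {φ : Lp E 2 (volume : Measure V)}
    (hf : Integrable f) (hφ : Integrable (𝓕 φ : Lp E 2 (volume : Measure V))) :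
    ∫ ξ, inner ℂ (𝓕 f ξ) ((𝓕 φ : Lp E 2 (volume : Measure V)) ξ) = ∫ x, inner ℂ (f x) (φ x) := by
  have hinv : φ =ᵐ[volume] 𝓕⁻ ((𝓕 φ : Lp E 2 (volume : Measure V)) : V → E) := by
    simpa only [FourierTransform.fourierInv_fourier_eq] using fourierInv_ae_eq_of_integrable hφ
  rw [integral_inner_fourier_eq_of_integrable hf hφ]
  refine integral_congr_ae (hinv.mono fun x hx => ?_)
  simp only [← hx]

theorem integrable_fourier_of_memSobolev {s : ℝ} (hs : Module.finrank ℝ V < 2 * s)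
    {φ : Lp E 2 (volume : Measure V)} (hφ : TemperedDistribution.MemSobolev s 2 (φ : 𝓢'(V, E))) :
    Integrable (𝓕 φ : Lp E 2 (volume : Measure V)) := by
  obtain ⟨v, hv⟩ := hφ.fourier_memL1 hs
  rw [Lp.fourier_toTemperedDistribution_eq] at hv
  have hvφ : v =ᵐ[volume] (𝓕 φ : Lp E 2 (volume : Measure V)) :=
    ae_eq_of_integral_schwartz_smul_eq ((Lp.memLp v).locallyIntegrable le_rfl)
      ((Lp.memLp _).locallyIntegrable one_le_two) fun s => by
        simp only [← Lp.toTemperedDistribution_apply, hv]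
  exact (L1.integrable_coeFn v).congr hvφ

theorem integral_norm_sq_fourier (φ : Lp E 2 (volume : Measure V)) :
    ∫ ξ, ‖(𝓕 φ : Lp E 2 (volume : Measure V)) ξ‖ ^ 2 = ∫ x, ‖φ x‖ ^ 2 := by
  rw [integral_norm_sq_eq_norm_sq, integral_norm_sq_eq_norm_sq, Lp.norm_fourier_eq]

end L2

end FourierIntegral

section Calculus

variable {E : Type*} [NormedAddCommGroup E] [InnerProductSpace ℝ E] {h h' : ℝ → E} {w w' : ℝ → ℝ}

theorem hasDerivAt_norm_sq_div {x : ℝ} (hw : HasDerivAt w (w' x) x) (hh : HasDerivAt h (h' x) x)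
    (hx : w x ≠ 0) :
    HasDerivAt (fun x => ‖h x‖ ^ 2 / w x)
      (2 * inner ℝ (h' x) ((w x)⁻¹ • h x) - w' x * ‖(w x)⁻¹ • h x‖ ^ 2) x := by
  refine (hh.norm_sq.div hw hx).congr_deriv ?_
  rw [real_inner_smul_right, real_inner_comm, norm_smul, mul_pow, norm_inv, inv_pow,
    Real.norm_eq_abs, sq_abs]
  field_simp

theorem integral_Ioi_mul_norm_sq_eq {g : ℝ → E} {a C : ℝ}
    (hw : ∀ x ∈ Set.Ici a, HasDerivAt w (w' x) x) (hw0 : ∀ x ∈ Set.Ici a, w x ≠ 0)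
    (hwtop : Tendsto w atTop atTop) (hh : ∀ x ∈ Set.Ici a, HasDerivAt h (h' x) x)
    (hC : ∀ x ∈ Set.Ici a, ‖h x‖ ≤ C) (hgh : ∀ᵐ x ∂volume.restrict (Set.Ioi a), w x • g x = h x)
    (hint : IntegrableOn (fun x => inner ℝ (h' x) (g x)) (Set.Ioi a))
    (hsq : IntegrableOn (fun x => w' x * ‖g x‖ ^ 2) (Set.Ioi a)) :
    ∫ x in Set.Ioi a, w' x * ‖g x‖ ^ 2 =
      2 * (∫ x in Set.Ioi a, inner ℝ (h' x) (g x)) + ‖h a‖ ^ 2 / w a := by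
  have hae : (fun x => 2 * inner ℝ (h' x) (g x) - w' x * ‖g x‖ ^ 2)
      =ᵐ[volume.restrict (Set.Ioi a)] fun x =>
        2 * inner ℝ (h' x) ((w x)⁻¹ • h x) - w' x * ‖(w x)⁻¹ • h x‖ ^ 2 := by
    filter_upwards [hgh, ae_restrict_mem measurableSet_Ioi] with x hx hax
    rw [← hx, inv_smul_smul₀ (hw0 x (Set.Ioi_subset_Ici_self hax))]
  have hlim : Tendsto (fun x => ‖h x‖ ^ 2 / w x) atTop (𝓝 0) := by
    refine bdd_le_mul_tendsto_zero (b := 0) (B := C ^ 2) ?_ ?_ hwtop.inv_tendsto_atTop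
    · exact .of_forall fun x => by positivity
    · filter_upwards [eventually_ge_atTop a] with x hx
      gcongr
      exact hC x hx
  have hftc := integral_Ioi_of_hasDerivAt_of_tendsto'
    (fun x hx => hasDerivAt_norm_sq_div (hw x hx) (hh x hx) (hw0 x hx))
    (((hint.const_mul 2).sub hsq).congr hae) hlim
  rw [← integral_congr_ae hae, integral_sub (hint.const_mul 2) hsq, integral_const_mul] at hftc
  linarith

end Calculus

section Lax

variable {u : ℝ → ℝ} {hu : MemLp u ∞ volume}

theorem fourier_ae_eq_zero_of_notMem_Ioi (φ : hardyPlus) :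
    ∀ᵐ ξ : ℝ, ξ ∉ Set.Ioi 0 → (𝓕 (φ : L2) : L2) ξ = 0 := by
  have hφ : ∀ᵐ ξ : ℝ, ξ < 0 → (𝓕 (φ : L2) : L2) ξ = 0 := φ.2
  filter_upwards [hφ, Measure.ae_ne volume (0 : ℝ)] with ξ hneg hne hξ
  exact hneg (lt_of_le_of_ne (not_lt.1 hξ) hne)

theorem fourier_cauchyPlus (f : L2) :
    𝓕 (cauchyPlus f : L2) = mulOp posIndicator memLp_posIndicator (𝓕 f) :=
  FourierTransform.fourier_fourierInv_eq _

theorem cauchyPlus_coe (φ : hardyPlus) : cauchyPlus (φ : L2) = φ := by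
  have hfix : mulOp posIndicator memLp_posIndicator (𝓕 (φ : L2)) = 𝓕 (φ : L2) := by
    apply Lp.ext
    filter_upwards [mulOp_ae posIndicator memLp_posIndicator (𝓕 (φ : L2)),
      fourier_ae_eq_zero_of_notMem_Ioi φ] with ξ hmul hzero
    by_cases hξ : ξ ∈ Set.Ioi 0
    · rw [hmul, posIndicator, Set.indicator_of_mem hξ, Pi.one_apply, one_mul]
    · rw [hmul, hzero hξ, mul_zero]
  ext1
  change 𝓕⁻ (mulOp posIndicator memLp_posIndicator (𝓕 (φ : L2))) = (φ : L2)
  rw [hfix, FourierTransform.fourierInv_fourier_eq]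

theorem coe_laxOp_apply {φ : hardyPlus} (hφ : φ ∈ (laxOp u hu).domain) :
    (laxOp u hu ⟨φ, hφ⟩ : L2) =
      (1 / I) • weakDeriv ⟨φ, hφ⟩ - cauchyPlus (mulOp (fun x => (u x : ℂ)) hu.ofReal φ) := by
  change (1 / I) • weakDeriv ⟨φ, hφ⟩ -
    (cauchyPlus (mulOp (fun x => (u x : ℂ)) hu.ofReal (cauchyPlus (φ : L2))) : L2) = _
  rw [cauchyPlus_coe]

theorem fourier_laxOp_ae {φ : hardyPlus} (hφ : φ ∈ (laxOp u hu).domain) :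
    (𝓕 (laxOp u hu ⟨φ, hφ⟩ : L2) : L2) =ᵐ[volume] fun ξ : ℝ =>
      2 * Real.pi * ξ * (𝓕 (φ : L2) : L2) ξ -
        posIndicator ξ * (𝓕 (mulOp (fun x => (u x : ℂ)) hu.ofReal φ) : L2) ξ := by
  set d : L2 := weakDeriv ⟨φ, hφ⟩ with hd
  set k : L2 := mulOp (fun x => (u x : ℂ)) hu.ofReal φ
  have hsub : (𝓕 (laxOp u hu ⟨φ, hφ⟩ : L2) : L2) =
      (1 / I) • 𝓕 d - mulOp posIndicator memLp_posIndicator (𝓕 k) := by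
    rw [coe_laxOp_apply, ← fourier_cauchyPlus, ← FourierTransform.fourier_smul]
    exact (Lp.fourierTransformₗᵢ ℝ ℂ).map_sub _ _
  rw [hsub]
  filter_upwards [Lp.coeFn_sub ((1 / I) • 𝓕 d) (mulOp posIndicator memLp_posIndicator (𝓕 k)),
    Lp.coeFn_smul (1 / I) (𝓕 d), fourier_weakDeriv_ae ⟨φ, hφ⟩,
    mulOp_ae posIndicator memLp_posIndicator (𝓕 k)] with ξ hξ hsmul hderiv hmul
  rw [hξ, Pi.sub_apply, hsmul, Pi.smul_apply, hd, hderiv, hmul, smul_eq_mul]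
  field_simp

theorem fourier_mulOp_ae {m : ℝ → ℂ} (hm : MemLp m ∞ volume) {φ : L2}
    (hint : Integrable fun x => m x * φ x) :
    (𝓕 (mulOp m hm φ) : L2) =ᵐ[volume] 𝓕 fun x => m x * φ x :=
  (fourier_ae_eq_of_integrable (hint.congr (mulOp_ae m hm φ).symm)).trans
    (.of_forall (Real.fourier_congr_ae (mulOp_ae m hm φ)))

theorem IsEigenvector.fourier_ae {z : ℂ} {φ : hardyPlus} (hφ : IsEigenvector (laxOp u hu) z φ)
    (hint : Integrable fun x => (u x : ℂ) * (φ : L2) x) :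
    ∀ᵐ ξ : ℝ, 0 < ξ → (2 * Real.pi * ξ - z) * (𝓕 (φ : L2) : L2) ξ =
      𝓕 (fun x => (u x : ℂ) * (φ : L2) x) ξ := by
  obtain ⟨-, hdom, heq⟩ := hφ
  have hlax := fourier_laxOp_ae hdom
  rw [heq, Submodule.coe_smul, FourierTransform.fourier_smul] at hlax
  filter_upwards [hlax, Lp.coeFn_smul z (𝓕 (φ : L2)),
    fourier_mulOp_ae (m := fun x => (u x : ℂ)) hu.ofReal hint] with ξ hξ hsmul hmul hpos
  rw [hsmul, hmul, posIndicator, Set.indicator_of_mem (Set.mem_Ioi.2 hpos), Pi.smul_apply,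
    smul_eq_mul, Pi.one_apply, one_mul] at hξ
  linear_combination -hξ

theorem re_integral_inner_I_mul_eq_zero {α : Type*} [MeasurableSpace α] {μ : Measure α}
    (r : α → ℝ) (f : α → ℂ) : (∫ x, inner ℂ (I * r x * f x) (f x) ∂μ).re = 0 := by
  have hpt (x : α) : inner ℂ (I * r x * f x) (f x) = -I * (r x * ‖f x‖ ^ 2 : ℝ) := by
    rw [RCLike.inner_apply, map_mul, map_mul, conj_I, conj_ofReal]
    push_cast
    rw [← mul_conj']
    ring
  simp_rw [hpt]
  rw [integral_const_mul, integral_complex_ofReal]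
  simp

theorem two_pi_mul_integral_norm_sq_eq_of_fourier_ae {lam : ℝ} (hlam : lam < 0) {φ : hardyPlus}
    (hφ : Integrable (𝓕 (φ : L2) : L2)) {f : ℝ → ℂ} (hf : Integrable f)
    (hxf : Integrable fun x : ℝ => x • f x)
    (heq : ∀ᵐ ξ : ℝ, 0 < ξ → (2 * Real.pi * ξ - lam) * (𝓕 (φ : L2) : L2) ξ = 𝓕 f ξ) :
    2 * Real.pi * ∫ x, ‖(φ : L2) x‖ ^ 2 =
      2 * (∫ x : ℝ, inner ℂ ((-2 * Real.pi * I * x) • f x) ((φ : L2) x)).re +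
        ‖∫ x, f x‖ ^ 2 / |lam| := by
  set g : L2 := 𝓕 (φ : L2)
  set f' : ℝ → ℂ := fun x => (-2 * Real.pi * I * x) • f x
  have hf'int : Integrable f' :=
    (hxf.const_mul (-2 * Real.pi * I)).congr (.of_forall fun x => by simp [f', mul_assoc])
  have hpos {ξ : ℝ} (hξ : ξ ∈ Set.Ici 0) : 0 < 2 * Real.pi * ξ - lam := by
    have := mul_nonneg Real.two_pi_pos.le hξ
    linarith
  have hlinear : ∀ᵐ ξ ∂volume.restrict (Set.Ioi 0), (2 * Real.pi * ξ - lam) • g ξ = 𝓕 f ξ := by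
    filter_upwards [ae_restrict_of_ae heq, ae_restrict_mem measurableSet_Ioi] with ξ hξ hξpos
    rw [← hξ hξpos, real_smul]
    push_cast
    rfl
  have hbalance := integral_Ioi_mul_norm_sq_eq
    (fun ξ _ => by simpa using ((hasDerivAt_id ξ).const_mul (2 * Real.pi)).sub_const lam)
    (fun ξ hξ => (hpos hξ).ne')
    (tendsto_atTop_add_const_right _ _ (tendsto_id.const_mul_atTop Real.two_pi_pos))
    (fun ξ _ => Real.hasDerivAt_fourier hf hxf ξ) (fun ξ _ => norm_fourier_le_integral_norm f ξ)
    hlinear (integrable_inner_fourier hf'int hφ).re.integrableOn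
    (((Lp.memLp g).integrable_norm_pow two_ne_zero).const_mul _).integrableOn
  have hparseval : ∫ ξ, inner ℝ (𝓕 f' ξ) (g ξ) = (∫ x, inner ℂ (f' x) ((φ : L2) x)).re := by
    rw [← integral_inner_fourier_fourier_of_integrable hf'int hφ]
    exact integral_re (integrable_inner_fourier hf'int hφ)
  have hsupp := fourier_ae_eq_zero_of_notMem_Ioi φ
  have hzero : 𝓕 f 0 = ∫ x, f x := by simp [Real.fourier_eq]
  rwa [setIntegral_eq_integral_of_ae_compl_eq_zero (hsupp.mono fun ξ h hξ => by simp [g, h hξ]),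
    setIntegral_eq_integral_of_ae_compl_eq_zero (hsupp.mono fun ξ h hξ => by simp [g, h hξ]),
    hparseval, integral_const_mul, integral_norm_sq_fourier, hzero, mul_zero, zero_sub,
    ← abs_of_neg hlam] at hbalance

theorem IsEigenvector.norm_integral_mul_sq {lam : ℝ} (hlam : lam < 0) {φ : hardyPlus}
    (hφ : IsEigenvector (laxOp u hu) lam φ)
    (hint : Integrable fun x => (u x : ℂ) * (φ : L2) x)
    (hxint : Integrable fun x : ℝ => x • ((u x : ℂ) * (φ : L2) x)) :
    ‖∫ x, (u x : ℂ) * (φ : L2) x‖ ^ 2 = 2 * Real.pi * |lam| * ∫ x, ‖(φ : L2) x‖ ^ 2 := by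
  have hfourier : Integrable (𝓕 (φ : L2) : L2) :=
    integrable_fourier_of_memSobolev (s := 1) (by simp) hφ.2.1
  have hcross : (∫ x : ℝ, inner ℂ ((-2 * Real.pi * I * x) • ((u x : ℂ) * (φ : L2) x))
      ((φ : L2) x)).re = 0 := by
    rw [← re_integral_inner_I_mul_eq_zero (fun x => -2 * Real.pi * x * u x) (φ : L2)]
    congr! 4
    simp only [smul_eq_mul]
    push_cast
    ring
  have hbalance := two_pi_mul_integral_norm_sq_eq_of_fourier_ae hlam hfourier hint hxint
    (hφ.fourier_ae hint)
  rw [hcross, mul_zero, zero_add, eq_div_iff (abs_ne_zero.2 hlam.ne)] at hbalance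
  linarith

end Lax

end BenjaminOno

theorem mainTheorem2 (u : ℝ → ℝ) (hu2 : MemLp u 2 volume) (huTop : MemLp u ∞ volume)
    (hxu : MemLp (fun x : ℝ => x * u x) 2 volume)
    (lam : ℝ) (hlam : lam < 0) (φ : BenjaminOno.hardyPlus)
    (hφ : BenjaminOno.IsEigenvector (BenjaminOno.laxOp u huTop) (lam : ℂ) φ) :
    Integrable (fun x : ℝ => (u x : ℂ) * (φ : BenjaminOno.L2) x) volume ∧
    ‖(∫ x : ℝ, (u x : ℂ) * (φ : BenjaminOno.L2) x)‖ ^ 2 =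
      2 * Real.pi * |lam| * (∫ x : ℝ, ‖(φ : BenjaminOno.L2) x‖ ^ 2) ∧
    (∫ x : ℝ, (u x : ℂ) * (φ : BenjaminOno.L2) x) ≠ 0 := by
  open BenjaminOno in
  have hint : Integrable fun x => (u x : ℂ) * (φ : L2) x :=
    hu2.ofReal.integrable_mul (Lp.memLp (φ : L2))
  have hxint : Integrable fun x : ℝ => x • ((u x : ℂ) * (φ : L2) x) := by
    refine (hxu.ofReal.integrable_mul (Lp.memLp (φ : L2))).congr (.of_forall fun x => ?_)
    simp [mul_assoc]
  have hnorm := hφ.norm_integral_mul_sq hlam hint hxint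
  refine ⟨hint, hnorm, fun hzero => hφ.1 (Subtype.ext (norm_eq_zero.1 ?_))⟩
  simpa [hzero, integral_norm_sq_eq_norm_sq, Real.pi_ne_zero, hlam.ne] using hnorm
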